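/- Let $K$ be a function field in one variable over a finite field of characteristic $3$, let $L/K$ be a separable extension of degree $3$, and let $y$ be a primitive element of $L/K$ whose minimal polynomial over $K$ is $X^3+aX+a^2$, with $a\in K$. Fix $j\in\{1,2\}$ (either choice) and, for $w\in K$, put $$\alpha_w=\frac{\bigl(ja^2+(w^3+aw)\bigr)^2}{a^3}\in K .$$ Let $\mathfrak p$ be a place of $K$, with normalized discrete valuation $v_{\mathfrak p}$. Call $\mathfrak p$ fully ramified in $L$ if some place of $L$ above it has ramification index $3=[L:K]$, and partially ramified in $L$ if it is ramified (some place of $L$ above it has ramification index greater than $1$) but not fully ramified. Then: 1. $\mathfrak p$ is fully ramified in $L$ if and only if there is $w\in K$ with $v_{\mathfrak p}(\alpha_w)<0$ and $\gcd(v_{\mathfrak p}(\alpha_w),3)=1$. Equivalently, there are $\alpha\in K$ and a primitive element $z$ of $L/K$ with minimal polynomial $X^3+\alpha X+\alpha^2$ such that $v_{\mathfrak p}(\alpha)<0$ and $\gcd(v_{\mathfrak p}(\alpha),3)=1$. 2. $\mathfrak p$ is partially ramified in $L$ if and only if $\gcd(v_{\mathfrak p}(a),2)=1$ and there is $w\in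 K$ with $v_{\mathfrak p}(\alpha_w)\ge 0$. The existence of such a $w$ is equivalent to the existence of $\alpha\in K$ and a primitive element $z$ of $L/K$ with minimal polynomial $X^3+\alpha X+\alpha^2$ such that $v_{\mathfrak p}(\alpha)\ge 0$. -/

import Mathlib

open Polynomial IntermediateField

/-- A place of the field `F` over the field of constants `k`, given by its valuation ring: a
discrete valuation ring of `F` (with fraction field `F`) that contains `k`. -/
structure Place (k F : Type*) [Field k] [Field F] [Algebra k F] where
  /-- The valuation ring of the place. -/
  ring : ValuationSubring F
  /-- The valuation ring is a discrete valuation ring (in particular, it is not all of `F`). -/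
  isDVR : IsDiscreteValuationRing ring
  /-- The valuation ring contains the constants. -/
  algebraMap_mem : ∀ c : k, algebraMap k F c ∈ ring

attribute [instance] Place.isDVR

namespace Place

/-- The normalized additive valuation of a place at a nonzero element of `F`: the order at
the maximal ideal of the valuation ring. (By convention the value at `0` is `0`.) -/
noncomputable def ord {k F : Type*} [Field k] [Field F] [Algebra k F] (p : Place k F)
    (z : F) : ℤ :=
  -WithZero.log ((IsDiscreteValuationRing.maximalIdeal p.ring).valuation F z)

section Extension

variable {k K L : Type*} [Field k] [Field K] [Field L] [Algebra k K] [Algebra k L] [Algebra K L]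

/-- The place `P` of `L` lies above the place `p` of `K`. -/
def LiesAbove (P : Place k L) (p : Place k K) : Prop :=
  P.ring.comap (algebraMap K L) = p.ring

/-- `e` is the ramification index of the place `P` of `L` over the place `p` of `K`: it is the
positive integer with `v_P(z) = e * v_p(z)` for all `z` in `K`. -/
def IsRamificationIndex (P : Place k L) (p : Place k K) (e : ℕ) : Prop :=
  0 < e ∧ ∀ z : K, z ≠ 0 → P.ord (algebraMap K L z) = e * p.ord z

variable (L)

/-- The place `p` of `K` is ramified in `L`: some place above it has ramification index
greater than `1`. -/
def Ramified (p : Place k K) : Prop :=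
  ∃ P : Place k L, P.LiesAbove p ∧ ∃ e : ℕ, P.IsRamificationIndex p e ∧ 1 < e

/-- The place `p` of `K` is fully ramified in `L`: some place above it has ramification index
equal to the degree of `L` over `K`. -/
def FullyRamified (p : Place k K) : Prop :=
  ∃ P : Place k L, P.LiesAbove p ∧ P.IsRamificationIndex p (Module.finrank K L)

/-- The place `p` of `K` is partially ramified in `L`: it is ramified but not fully ramified. -/
def PartiallyRamified (p : Place k K) : Prop :=
  p.Ramified L ∧ ¬ p.FullyRamified L

end Extension

end Place

/-- The element `(j a² + (w³ + a w))² / a³`. -/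
def cubicParam {K : Type*} [Field K] (a : K) (j : ℕ) (w : K) : K :=
  ((j : K) * a ^ 2 + (w ^ 3 + a * w)) ^ 2 / a ^ 3

/-- `z` generates `L` over `K` and has minimal polynomial `X³ + a X + a²`. -/
def IsCubicGenerator {K L : Type*} [Field K] [Field L] [Algebra K L] (a : K) (z : L) : Prop :=
  K⟮z⟯ = ⊤ ∧ minpoly K z = X ^ 3 + C a * X + C (a ^ 2)

/-! Write f(w) = w³ + a w + a². In characteristic 3 the element y - w is a root of X³ + a X + f(w),
and rescaling it shows that the parameters α of cubic generators are exactly the f(w)²/a³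
(`exists_isCubicGenerator_iff`); up to w ↦ -w these are the α_w. Hence ord α = 2 ord f(w) - 3 ord a
has the parity of ord a, and any convenient generator may replace y.

Ramification is read off the cubic equation, in which the least order must occur twice
(`ord_sub_cases`). If e = 3, some y - c has order prime to 3, and this forces its α to have a pole
of order prime to 3. Conversely, such a pole forces 3 ∣ e. If 3 ∤ e, some parameter is integral:
otherwise a c of maximal ord f(c) could be improved, because the residue field is perfect
(`exists_le_two_mul_ord`).

Let α be an integral parameter, with generator z. If ord α is even, scaling z makes the linear
coefficient a unit and e = 1 everywhere above p (`eq_one_of_isUnit`). If ord α is odd, a pole of z/α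
gives a ramified place, while e = 3 is impossible. -/

namespace Place

/-! ### Arithmetic of the normalized order. -/

section Ord

open WithZero

variable {k F : Type*} [Field k] [Field F] [Algebra k F] (p : Place k F)

/-- The multiplicative valuation of a place. -/
noncomputable def val : Valuation F (WithZero (Multiplicative ℤ)) :=
  (IsDiscreteValuationRing.maximalIdeal p.ring).valuation F

theorem val_eq_exp {x : F} (hx : x ≠ 0) : p.val x = exp (-p.ord x) := by
  have h : p.val x ≠ 0 := (Valuation.ne_zero_iff _).mpr hx
  rw [ord, neg_neg]
  exact (exp_log h).symm

theorem ord_eq_iff {x : F} (hx : x ≠ 0) {n : ℤ} : p.ord x = n ↔ p.val x = exp (-n) := by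
  rw [val_eq_exp p hx, exp_inj, neg_inj]

theorem val_lt_iff {x y : F} (hx : x ≠ 0) (hy : y ≠ 0) : p.val x < p.val y ↔ p.ord y < p.ord x := by
  rw [val_eq_exp p hx, val_eq_exp p hy, exp_lt_exp, neg_lt_neg_iff]

theorem val_le_iff {x y : F} (hx : x ≠ 0) (hy : y ≠ 0) : p.val x ≤ p.val y ↔ p.ord y ≤ p.ord x := by
  rw [val_eq_exp p hx, val_eq_exp p hy, exp_le_exp, neg_le_neg_iff]

@[simp] theorem ord_one : p.ord 1 = 0 := by simp [ord]

theorem ord_mul {x y : F} (hx : x ≠ 0) (hy : y ≠ 0) : p.ord (x * y) = p.ord x + p.ord y := by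
  rw [ord_eq_iff p (mul_ne_zero hx hy), map_mul, val_eq_exp p hx, val_eq_exp p hy, ← exp_add]
  congr 1
  ring

theorem ord_inv (x : F) : p.ord x⁻¹ = -p.ord x := by
  simp [ord, log_inv]

theorem ord_div {x y : F} (hx : x ≠ 0) (hy : y ≠ 0) : p.ord (x / y) = p.ord x - p.ord y := by
  rw [div_eq_mul_inv, ord_mul p hx (inv_ne_zero hy), ord_inv, sub_eq_add_neg]

theorem ord_pow (x : F) (n : ℕ) : p.ord (x ^ n) = n * p.ord x := by
  simp [ord, log_pow]

theorem ord_zpow (x : F) (n : ℤ) : p.ord (x ^ n) = n * p.ord x := by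
  simp [ord, log_zpow]

@[simp] theorem ord_neg (x : F) : p.ord (-x) = p.ord x := by
  simp [ord, Valuation.map_neg]

theorem mem_ring_iff {x : F} (hx : x ≠ 0) : x ∈ p.ring ↔ 0 ≤ p.ord x := by
  have h : 0 ≤ p.ord x ↔ p.val x ≤ 1 := by
    rw [← ord_one p, ← val_le_iff p hx one_ne_zero, map_one]
  rw [h]
  constructor
  · intro hx
    exact IsDedekindDomain.HeightOneSpectrum.valuation_le_one _ (⟨x, hx⟩ : p.ring)
  · intro hx
    obtain ⟨a, rfl⟩ := IsDiscreteValuationRing.exists_lift_of_le_one hx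
    exact a.2

theorem exists_ord_eq_one : ∃ π : F, π ≠ 0 ∧ p.ord π = 1 := by
  obtain ⟨π, hπ⟩ :=
    (IsDiscreteValuationRing.maximalIdeal p.ring).valuation_exists_uniformizer F
  have h0 : π ≠ 0 := by
    rintro rfl
    rw [map_zero] at hπ
    exact exp_ne_zero hπ.symm
  exact ⟨π, h0, (ord_eq_iff p h0).mpr hπ⟩

theorem ord_add_of_lt {x y : F} (hx : x ≠ 0) (hy : y ≠ 0) (h : p.ord x < p.ord y) :
    x + y ≠ 0 ∧ p.ord (x + y) = p.ord x := by
  have hv := p.val.map_add_eq_of_lt_left ((val_lt_iff p hy hx).mpr h)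
  have h0 : x + y ≠ 0 := by
    rw [← Valuation.ne_zero_iff p.val, hv]
    exact (Valuation.ne_zero_iff _).mpr hx
  exact ⟨h0, by rw [ord_eq_iff p h0, hv, val_eq_exp p hx]⟩

/-- In a vanishing sum of three nonzero terms, no term has strictly minimal order. -/
theorem not_ord_lt_of_add_eq_zero {x y z : F} (hx : x ≠ 0) (hy : y ≠ 0)
    (h : x + y + z = 0) : ¬(p.ord x < p.ord y ∧ p.ord x < p.ord z) := by
  rintro ⟨h1, h2⟩
  obtain ⟨-, h3⟩ := ord_add_of_lt p hx hy h1
  rw [← h3, show x + y = -z by linear_combination h, ord_neg] at h2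
  exact lt_irrefl _ h2

/-- A nonempty sum of nonzero terms of distinct orders is nonzero, and its order is the order of
one of the terms. -/
theorem exists_ord_sum_eq {ι : Type*} {s : Finset ι} (hs : s.Nonempty) (f : ι → F)
    (hf : ∀ i ∈ s, f i ≠ 0) (hinj : Set.InjOn (fun i => p.ord (f i)) s) :
    ∑ i ∈ s, f i ≠ 0 ∧ ∃ i ∈ s, p.ord (∑ i ∈ s, f i) = p.ord (f i) := by
  classical
  induction hs using Finset.Nonempty.cons_induction with
  | singleton i => simpa using hf
  | cons i s hi hs ih =>
    obtain ⟨h0, j, hj, hord⟩ := ih (fun l hl => hf l (by simp [hl]))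
      (hinj.mono (by simp))
    have hi0 := hf i (by simp)
    have hne : p.ord (f i) ≠ p.ord (f j) := fun h => by
      have := hinj (by simp) (by simp [hj]) h
      exact hi (this ▸ hj)
    rw [Finset.sum_cons]
    rcases lt_or_gt_of_ne hne with hlt | hlt
    · obtain ⟨h1, h2⟩ := ord_add_of_lt p hi0 h0 (by rwa [hord])
      exact ⟨h1, i, by simp, h2⟩
    · obtain ⟨h1, h2⟩ := ord_add_of_lt p h0 hi0 (by rwa [hord])
      rw [add_comm]
      exact ⟨h1, j, by simp [hj], h2.trans hord⟩

/-- A root of an integral polynomial `X³ + b X + c` is integral. -/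
theorem mem_ring_of_cubic {x b c : F} (hb : b ∈ p.ring) (hc : c ∈ p.ring)
    (h : x ^ 3 + b * x + c = 0) : x ∈ p.ring := by
  rcases p.ring.mem_or_inv_mem x with hx | hx
  · exact hx
  · by_cases h0 : x = 0
    · rw [h0]
      exact p.ring.zero_mem
    -- The equation divided by x² writes x as an integral expression in x⁻¹.
    have : x = -(b * x⁻¹ + c * (x⁻¹ * x⁻¹)) := by
      field_simp
      linear_combination h
    rw [this]
    exact p.ring.neg_mem _ (p.ring.add_mem _ _ (p.ring.mul_mem _ _ hb hx)
      (p.ring.mul_mem _ _ hc (p.ring.mul_mem _ _ hx hx)))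

end Ord

end Place

/-! ### Places above a place, and ramification indices. -/

namespace Place

section Extension

variable {k K L : Type*} [Field k] [Field K] [Field L] [Algebra k K] [Algebra k L] [Algebra K L]

theorem LiesAbove.mem_iff {P : Place k L} {p : Place k K} (h : P.LiesAbove p) (x : K) :
    algebraMap K L x ∈ P.ring ↔ x ∈ p.ring := by
  rw [← h, ValuationSubring.mem_comap]

/-- The index is the order at P of a uniformizer π of p, since z / π ^ ord z is a unit at p and
hence at P. -/
theorem LiesAbove.exists_isRamificationIndex {P : Place k L} {p : Place k K}
    (h : P.LiesAbove p) : ∃ e : ℕ, P.IsRamificationIndex p e := by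
  obtain ⟨π, hπ0, hπ⟩ := p.exists_ord_eq_one
  have hinj : ∀ {x : K}, x ≠ 0 → algebraMap K L x ≠ 0 := fun hx => by simpa using hx
  have hiff : ∀ {x : K}, x ≠ 0 → (0 ≤ P.ord (algebraMap K L x) ↔ 0 ≤ p.ord x) := fun hx => by
    rw [← mem_ring_iff _ (hinj hx), h.mem_iff, mem_ring_iff _ hx]
  have hpos : 0 < P.ord (algebraMap K L π) := by
    have h1 := (hiff hπ0).mpr (by omega)
    have h2 := (hiff (inv_ne_zero hπ0)).not.mpr (by rw [ord_inv]; omega)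
    rw [map_inv₀, ord_inv] at h2
    omega
  refine ⟨(P.ord (algebraMap K L π)).toNat, by omega, fun z hz => ?_⟩
  rw [Int.toNat_of_nonneg hpos.le]
  have hu : z / π ^ p.ord z ≠ 0 := div_ne_zero hz (zpow_ne_zero _ hπ0)
  have hu0 : p.ord (z / π ^ p.ord z) = 0 := by
    rw [ord_div _ hz (zpow_ne_zero _ hπ0), ord_zpow, hπ]
    ring
  have h1 := (hiff hu).mpr hu0.ge
  have h2 := (hiff (inv_ne_zero hu)).mpr (by rw [ord_inv, hu0]; simp)
  rw [map_inv₀, ord_inv] at h2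
  have h3 : P.ord (algebraMap K L (z / π ^ p.ord z)) = 0 := by omega
  rw [map_div₀, map_zpow₀, ord_div _ (hinj hz) (zpow_ne_zero _ (hinj hπ0)), ord_zpow] at h3
  linarith

namespace IsRamificationIndex

variable {P : Place k L} {p : Place k K} {e : ℕ} (he : P.IsRamificationIndex p e)
include he

/-- A sum `∑ cᵢ πⁱ` with `i < e` and some `cᵢ ≠ 0` has order congruent modulo `e` to one of the
indices with `cᵢ ≠ 0`. -/
theorem exists_ord_sum_pow {π : L} (hπ0 : π ≠ 0) (hπ : P.ord π = 1) (c : Fin e → K)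
    (hc : ∃ i, c i ≠ 0) :
    ∑ i, c i • π ^ (i : ℕ) ≠ 0 ∧
      ∃ i, c i ≠ 0 ∧ (e : ℤ) ∣ P.ord (∑ i, c i • π ^ (i : ℕ)) - (i : ℕ) := by
  classical
  set s : Finset (Fin e) := Finset.univ.filter (fun i => c i ≠ 0) with hs
  have hmem : ∀ i, i ∈ s ↔ c i ≠ 0 := fun i => by simp [hs]
  have hsum : ∑ i, c i • π ^ (i : ℕ) = ∑ i ∈ s, c i • π ^ (i : ℕ) := by
    rw [hs, Finset.sum_filter_of_ne]
    rintro i - h h0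
    exact h (by rw [h0, zero_smul])
  have hord : ∀ i ∈ s, P.ord (c i • π ^ (i : ℕ)) = e * p.ord (c i) + (i : ℕ) := fun i hi => by
    have := (hmem i).mp hi
    rw [Algebra.smul_def, ord_mul _ (by simpa using this) (pow_ne_zero _ hπ0), he.2 _ this,
      ord_pow, hπ, mul_one]
  obtain ⟨h0, i, hi, h1⟩ := P.exists_ord_sum_eq (s := s)
    (by obtain ⟨i, hi⟩ := hc; exact ⟨i, (hmem i).mpr hi⟩) (fun i => c i • π ^ (i : ℕ))
    (fun i hi => smul_ne_zero ((hmem i).mp hi) (pow_ne_zero _ hπ0))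
    (fun i hi j hj hij => by
      simp only at hij
      rw [hord i hi, hord j hj] at hij
      have h1 := congrArg (· % (e : ℤ)) hij
      simp only [Int.mul_add_emod_self_left] at h1
      have h2 := i.2
      have h3 := j.2
      rw [Int.emod_eq_of_lt (by omega) (by omega), Int.emod_eq_of_lt (by omega) (by omega)] at h1
      exact Fin.ext (by exact_mod_cast h1))
  rw [hsum]
  refine ⟨h0, i, (hmem i).mp hi, ?_⟩
  rw [h1, hord i hi]
  simp

/-- Nonzero terms cᵢ πⁱ have orders distinct modulo e, so they cannot cancel. -/
theorem linearIndependent_pow {π : L} (hπ0 : π ≠ 0) (hπ : P.ord π = 1) :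
    LinearIndependent K (fun i : Fin e => π ^ (i : ℕ)) := by
  rw [Fintype.linearIndependent_iff]
  intro c hc
  by_contra! h
  exact (he.exists_ord_sum_pow hπ0 hπ c h).1 hc

theorem le_finrank [FiniteDimensional K L] : e ≤ Module.finrank K L := by
  obtain ⟨π, hπ0, hπ⟩ := P.exists_ord_eq_one
  simpa using (he.linearIndependent_pow hπ0 hπ).fintype_card_le_finrank

/-- If `P` is fully ramified, every element outside `K` can be translated by an element of `K`
to make its order prime to the ramification. -/
theorem exists_not_dvd_ord_sub [FiniteDimensional K L] (hn : e = Module.finrank K L) {z : L}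
    (hz : z ∉ (algebraMap K L).range) :
    ∃ c : K, ¬ (e : ℤ) ∣ P.ord (z - algebraMap K L c) := by
  obtain ⟨π, hπ0, hπ⟩ := P.exists_ord_eq_one
  have hspan := (he.linearIndependent_pow hπ0 hπ).span_eq_top_of_card_eq_finrank'
    (by simpa using hn)
  obtain ⟨c, hc⟩ := (Submodule.mem_span_range_iff_exists_fun K).mp
    (hspan ▸ Submodule.mem_top : z ∈ Submodule.span K _)
  have hepos := he.1
  set o : Fin e := ⟨0, hepos⟩ with ho
  -- Removing the constant coefficient of z in the basis πⁱ leaves exponents 0 < i < e, none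
  -- divisible by e.
  refine ⟨c o, ?_⟩
  have hdiff : z - algebraMap K L (c o) = ∑ i, (Function.update c o 0) i • π ^ (i : ℕ) := by
    rw [← hc, sub_eq_iff_eq_add, ← Finset.add_sum_erase _ _ (Finset.mem_univ o),
      ← Finset.add_sum_erase (a := o) _ (fun i => Function.update c o 0 i • π ^ (i : ℕ))
        (Finset.mem_univ o)]
    have : ∀ i ∈ Finset.univ.erase o, Function.update c o 0 i • π ^ (i : ℕ) = c i • π ^ (i : ℕ) :=
      fun i hi => by rw [Function.update_of_ne (Finset.ne_of_mem_erase hi)]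
    rw [Finset.sum_congr rfl this]
    simp [ho, Algebra.smul_def, add_comm]
  have hex : ∃ i, Function.update c o 0 i ≠ 0 := by
    by_contra! h
    apply hz
    refine ⟨c o, ?_⟩
    rw [eq_comm, ← sub_eq_zero, hdiff]
    simp [h]
  obtain ⟨-, i, hi, hdvd⟩ := he.exists_ord_sum_pow hπ0 hπ _ hex
  rw [hdiff]
  intro h
  have hio : i ≠ o := by
    rintro rfl
    simp at hi
  have h1 : (e : ℤ) ∣ (i : ℕ) := (Int.dvd_iff_dvd_of_dvd_sub hdvd).mp h
  rw [Int.natCast_dvd_natCast] at h1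
  have h2 := Nat.eq_zero_of_dvd_of_lt h1 i.2
  exact hio (Fin.ext h2)

end IsRamificationIndex

/-- The place of `F` attached to a maximal ideal of a Dedekind domain with fraction field `F`. -/
noncomputable def ofHeightOneSpectrum {k F : Type*} [Field k] [Field F] [Algebra k F]
    {R : Type*} [CommRing R] [IsDedekindDomain R] [Algebra R F] [IsFractionRing R F]
    (v : IsDedekindDomain.HeightOneSpectrum R)
    (h : ∀ c : k, algebraMap k F c ∈ (algebraMap R F).range) : Place k F where
  ring := (v.valuation F).valuationSubring
  isDVR := by
    rw [← v.valuationSubringAtPrime_eq_valuationSubring]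
    exact IsLocalization.AtPrime.isDiscreteValuationRing_of_dedekind_domain R v.ne_bot _
  algebraMap_mem c := by
    obtain ⟨r, hr⟩ := h c
    rw [Valuation.mem_valuationSubring_iff, ← hr]
    exact v.valuation_le_one r

/-- If `t` is not integral over the valuation ring of `p`, then it has a pole at some place
above `p`. -/
theorem exists_liesAbove_notMem [IsScalarTower k K L] [FiniteDimensional K L]
    [Algebra.IsSeparable K L] (p : Place k K) {t : L}
    (ht : ¬ IsIntegral p.ring t) : ∃ P : Place k L, P.LiesAbove p ∧ t ∉ P.ring := by
  let B := integralClosure p.ring L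
  have hD : IsDedekindDomain B := IsIntegralClosure.isDedekindDomain p.ring K L B
  have hF : IsFractionRing B L := integralClosure.isFractionRing_of_finite_extension K L
  have hp : ∀ x : p.ring, algebraMap K L x ∈ (algebraMap B L).range := fun x =>
    ⟨algebraMap p.ring B x, by
      rw [← IsScalarTower.algebraMap_apply, IsScalarTower.algebraMap_apply p.ring K L]
      rfl⟩
  have hex : ∃ v : IsDedekindDomain.HeightOneSpectrum B, ¬ v.valuation L t ≤ 1 := by
    by_contra! h
    obtain ⟨b, rfl⟩ := IsDedekindDomain.HeightOneSpectrum.mem_integers_of_valuation_le_one L t h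
    exact ht b.2
  obtain ⟨v, hv⟩ := hex
  let P : Place k L := ofHeightOneSpectrum v fun c => by
    rw [IsScalarTower.algebraMap_apply k K L]
    exact hp ⟨_, p.algebraMap_mem c⟩
  have htP : t ∉ P.ring := hv
  refine ⟨P, ?_, htP⟩
  refine Eq.symm (a := p.ring) ?_
  have hle : p.ring ≤ P.ring.comap (algebraMap K L) := by
    intro x hx
    rw [ValuationSubring.mem_comap]
    obtain ⟨b, hb⟩ := hp ⟨x, hx⟩
    change _ ∈ (v.valuation L).valuationSubring
    rw [Valuation.mem_valuationSubring_iff, ← hb]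
    exact v.valuation_le_one b
  -- A discrete valuation ring is a maximal proper subring. If the contraction were all of K, then
  -- t, being integral over K, would lie in `P.ring`.
  refine ValuationSubring.eq_of_le_of_ne_top _ hle fun htop => htP ?_
  have hmem : ∀ x : K, algebraMap K L x ∈ P.ring := fun x => by
    rw [← ValuationSubring.mem_comap, htop]
    trivial
  let : Algebra K P.ring := ((algebraMap K L).codRestrict P.ring hmem).toAlgebra
  have : IsScalarTower K P.ring L := IsScalarTower.of_algebraMap_eq fun _ => rfl
  have hint : IsIntegral P.ring t := (Algebra.IsIntegral.isIntegral (R := K) t).tower_top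
  obtain ⟨b, hb⟩ := IsIntegrallyClosed.isIntegral_iff.mp hint
  rw [← hb]
  exact b.2

/-- Some place of `L` lies above `p`. -/
theorem exists_liesAbove [IsScalarTower k K L] [FiniteDimensional K L]
    [Algebra.IsSeparable K L] (p : Place k K) : ∃ P : Place k L, P.LiesAbove p := by
  obtain ⟨π, hπ0, hπ⟩ := p.exists_ord_eq_one
  have hni : ¬ IsIntegral p.ring (algebraMap K L π⁻¹) := by
    rw [isIntegral_algebraMap_iff (algebraMap K L).injective, IsIntegrallyClosed.isIntegral_iff]
    rintro ⟨b, hb⟩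
    have := (p.mem_ring_iff (inv_ne_zero hπ0)).mp (hb ▸ b.2)
    rw [ord_inv] at this
    omega
  obtain ⟨P, hP, -⟩ := p.exists_liesAbove_notMem hni
  exact ⟨P, hP⟩

end Extension

end Place

/-! ### The residue field and cubes modulo a uniformizer. -/

namespace Place

section ResidueField

variable {k K : Type*} [Field k] [Field K] [Algebra k K] (p : Place k K)

instance : Algebra k p.ring :=
  ((algebraMap k K).codRestrict p.ring p.algebraMap_mem).toAlgebra

instance : IsScalarTower k p.ring K := IsScalarTower.of_algebraMap_eq fun _ => rfl

/-- If x had transcendental residue, nonzero polynomials in x would be units, so k(x) would lie in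
the valuation ring. As K is finite over k(x), π⁻¹ would be integral over that ring, hence in it. -/
theorem residueField_isAlgebraic [Algebra (RatFunc k) K] [IsScalarTower k (RatFunc k) K]
    [FunctionField k K] : Algebra.IsAlgebraic k (IsLocalRing.ResidueField p.ring) := by
  constructor
  intro r
  by_contra hr
  obtain ⟨x, rfl⟩ := IsLocalRing.residue_surjective r
  let φ : p.ring →ₐ[k] IsLocalRing.ResidueField p.ring := IsScalarTower.toAlgHom k _ _
  let ι : p.ring →ₐ[k] K := IsScalarTower.toAlgHom k _ _
  have hx : Transcendental k (x : K) := fun h => hr <| by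
    have h1 : IsAlgebraic k x :=
      (isAlgebraic_algHom_iff ι (FaithfulSMul.algebraMap_injective p.ring K)).mp h
    exact h1.algHom φ
  have hfin := FunctionField.finiteDimensional_of_adjoin_transcendental hx
  have haeval : ∀ f : k[X], aeval (x : K) f = (aeval x f : p.ring) := fun f =>
    aeval_algHom_apply ι x f
  have hunit : ∀ f : k[X], aeval (x : K) f = 0 ∨ (aeval (x : K) f)⁻¹ ∈ p.ring := fun f => by
    by_cases hf : f = 0
    · simp [hf]
    right
    have h1 : φ (aeval x f) ≠ 0 := by
      rw [← aeval_algHom_apply]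
      exact fun h => hf (transcendental_iff.mp hr f h)
    have h2 : IsUnit (aeval x f) := (IsLocalRing.residue_ne_zero_iff_isUnit _).mp h1
    obtain ⟨u, hu⟩ := h2
    have h3 : (aeval (x : K) f)⁻¹ = (↑(u⁻¹) : p.ring) := by
      rw [haeval, ← hu]
      exact inv_eq_of_mul_eq_one_right (congrArg Subtype.val u.mul_inv)
    rw [h3]
    exact Subtype.prop _
  have hmem : ∀ z : k⟮(x : K)⟯, (z : K) ∈ p.ring := fun z => by
    obtain ⟨f, g, hfg⟩ := (mem_adjoin_simple_iff k (z : K)).mp z.2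
    rw [hfg]
    rcases hunit g with hg | hg
    · rw [hg, div_zero]
      exact p.ring.zero_mem
    · rw [haeval f, div_eq_mul_inv]
      exact p.ring.mul_mem _ _ (Subtype.prop _) hg
  let : Algebra k⟮(x : K)⟯ p.ring :=
    ((algebraMap k⟮(x : K)⟯ K).codRestrict p.ring hmem).toAlgebra
  have : IsScalarTower k⟮(x : K)⟯ p.ring K := IsScalarTower.of_algebraMap_eq fun _ => rfl
  obtain ⟨π, hπ0, hπ⟩ := p.exists_ord_eq_one
  have hint : IsIntegral p.ring π⁻¹ :=
    (Algebra.IsIntegral.isIntegral (R := k⟮(x : K)⟯) π⁻¹).tower_top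
  obtain ⟨b, hb⟩ := IsIntegrallyClosed.isIntegral_iff.mp hint
  have := (p.mem_ring_iff (inv_ne_zero hπ0)).mp (hb ▸ b.2)
  rw [ord_inv] at this
  omega

/-- Integral elements are cubes modulo a uniformizer, since the residue field is perfect. -/
theorem exists_eq_cube_add [Finite k] [CharP k 3] [Algebra (RatFunc k) K]
    [IsScalarTower k (RatFunc k) K] [FunctionField k K] {π : K} (hπ0 : π ≠ 0)
    (hπ : p.ord π = 1) {u : K} (hu : u ∈ p.ring) :
    ∃ s ∈ p.ring, ∃ v ∈ p.ring, u = s ^ 3 + π * v := by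
  have := p.residueField_isAlgebraic
  have : Fact (Nat.Prime 3) := ⟨Nat.prime_three⟩
  have : CharP (IsLocalRing.ResidueField p.ring) 3 :=
    charP_of_injective_algebraMap (algebraMap k _).injective 3
  have : ExpChar (IsLocalRing.ResidueField p.ring) 3 := ExpChar.prime Nat.prime_three
  have : PerfectField (IsLocalRing.ResidueField p.ring) :=
    Algebra.IsAlgebraic.perfectField (K := k)
  obtain ⟨r, hr⟩ := surjective_frobenius (IsLocalRing.ResidueField p.ring) 3
    (IsLocalRing.residue p.ring ⟨u, hu⟩)
  obtain ⟨s, rfl⟩ := IsLocalRing.residue_surjective r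
  have h0 : IsLocalRing.residue p.ring (⟨u, hu⟩ - s ^ 3) = 0 := by
    rw [map_sub, ← hr, map_pow, frobenius_def, sub_self]
  have hmem : (u - (s : K) ^ 3) / π ∈ p.ring := by
    by_cases h : u - (s : K) ^ 3 = 0
    · rw [h, zero_div]
      exact p.ring.zero_mem
    have h1 : u - (s : K) ^ 3 ∈ p.ring := p.ring.sub_mem hu (pow_mem s.2 3)
    have h2 : ¬ p.ord (u - (s : K) ^ 3) ≤ 0 := fun h2 => by
      have h3 : (u - (s : K) ^ 3)⁻¹ ∈ p.ring := by
        rw [mem_ring_iff _ (inv_ne_zero h), ord_inv]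
        omega
      refine (IsLocalRing.residue_ne_zero_iff_isUnit _).mpr ?_ h0
      exact IsUnit.of_mul_eq_one ⟨_, h3⟩ (Subtype.ext (mul_inv_cancel₀ h))
    rw [mem_ring_iff _ (div_ne_zero h hπ0), ord_div _ h hπ0, hπ]
    omega
  refine ⟨s, s.2, _, hmem, ?_⟩
  field_simp
  ring

end ResidueField

end Place

/-! ### Cubic generators and their parameters. -/

section CubicExtension

variable {K L : Type*} [Field K] [Field L] [Algebra K L]

/-- In a cubic extension, an element outside the base field is a generator, and a monic cubic
polynomial that kills it is its minimal polynomial. -/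
theorem adjoin_eq_top_and_minpoly_eq_of_finrank_eq_three (hdeg : Module.finrank K L = 3) {z : L}
    (hz : z ∉ (algebraMap K L).range) {f : K[X]} (hf : f.Monic) (hf3 : f.natDegree = 3)
    (h : aeval z f = 0) : K⟮z⟯ = ⊤ ∧ minpoly K z = f := by
  have hfd : FiniteDimensional K L := FiniteDimensional.of_finrank_eq_succ hdeg
  have hint : IsIntegral K z := Algebra.IsIntegral.isIntegral z
  have hdvd : Module.finrank K K⟮z⟯ ∣ 3 :=
    ⟨_, (hdeg ▸ Module.finrank_mul_finrank K K⟮z⟯ L).symm⟩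
  have hfin : Module.finrank K K⟮z⟯ = 3 := by
    refine (Nat.prime_three.eq_one_or_self_of_dvd _ hdvd).resolve_left fun h1 => hz ?_
    rw [IntermediateField.finrank_eq_one_iff, adjoin_simple_eq_bot_iff, mem_bot] at h1
    exact h1
  constructor
  · exact IntermediateField.eq_of_le_of_finrank_eq le_top (by rw [hfin, finrank_top', hdeg])
  · rw [adjoin.finrank hint] at hfin
    exact (eq_of_monic_of_dvd_of_natDegree_le (minpoly.monic hint) hf (minpoly.dvd K z h)
      (by omega)).symm

theorem natDegree_depressedCubic (b c : K) : (X ^ 3 + C b * X + C c).natDegree = 3 := by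
  compute_degree!

theorem monic_depressedCubic (b c : K) : (X ^ 3 + C b * X + C c).Monic := by
  monicity!

/-- A generator of a cubic extension yields quadratic expressions for all elements. -/
theorem exists_eq_quadratic {z : L} (hz : K⟮z⟯ = ⊤) (h3 : (minpoly K z).natDegree = 3) (x : L) :
    ∃ c₀ c₁ c₂ : K,
      x = algebraMap K L c₀ + algebraMap K L c₁ * z + algebraMap K L c₂ * z ^ 2 := by
  have hint : IsIntegral K z := by
    by_contra h
    rw [minpoly.eq_zero h] at h3
    simp at h3
  have hx : x ∈ K⟮z⟯.toSubalgebra := by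
    rw [hz]
    trivial
  rw [adjoin_simple_toSubalgebra_of_isAlgebraic hint.isAlgebraic,
    Algebra.adjoin_singleton_eq_range_aeval] at hx
  obtain ⟨f, rfl⟩ := hx
  have hmonic := minpoly.monic hint
  have hlt : (f %ₘ minpoly K z).natDegree < 3 := by
    rw [← h3]
    exact natDegree_modByMonic_lt _ hmonic (fun h => by rw [h] at h3; simp at h3)
  set g := f %ₘ minpoly K z with hg
  refine ⟨g.coeff 0, g.coeff 1, g.coeff 2, ?_⟩
  change aeval z f = _
  rw [← aeval_modByMonic_eq_self_of_root (minpoly.aeval K z), ← hg, aeval_eq_sum_range' hlt]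
  simp only [Finset.sum_range_succ, Finset.sum_range_zero, zero_add, pow_zero, pow_one,
    Algebra.smul_def, mul_one]

/-- Linear independence of the powers `1, z, z²` of an element of degree three. -/
theorem eq_zero_of_quadratic_eq_zero {z : L} (h3 : (minpoly K z).natDegree = 3) {c₀ c₁ c₂ : K}
    (h : algebraMap K L c₀ + algebraMap K L c₁ * z + algebraMap K L c₂ * z ^ 2 = 0) :
    c₀ = 0 ∧ c₁ = 0 ∧ c₂ = 0 := by
  have hq : C c₂ * X ^ 2 + C c₁ * X + C c₀ = 0 := by
    by_contra hne
    have h1 := natDegree_le_natDegree (minpoly.degree_le_of_ne_zero K z hne (by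
      simp only [map_add, map_mul, aeval_C, aeval_X, map_pow]
      linear_combination h))
    have h2 := natDegree_quadratic_le (a := c₂) (b := c₁) (c := c₀)
    omega
  have hc := fun n => congrArg (fun q => coeff q n) hq
  have hc0 := hc 0
  have hc1 := hc 1
  have hc2 := hc 2
  simp [coeff_X, coeff_C] at hc0 hc1 hc2
  exact ⟨hc0, hc1, hc2⟩

namespace IsCubicGenerator

variable {a : K} {z : L} (hz : IsCubicGenerator a z)
include hz

theorem natDegree_minpoly : (minpoly K z).natDegree = 3 := by
  rw [hz.2, natDegree_depressedCubic]

theorem isIntegral : IsIntegral K z := by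
  by_contra h
  have := hz.natDegree_minpoly
  rw [minpoly.eq_zero h] at this
  simp at this

theorem cubic_eq_zero : z ^ 3 + algebraMap K L a * z + algebraMap K L a ^ 2 = 0 := by
  have := minpoly.aeval K z
  rw [hz.2] at this
  simpa using this

theorem notMem_range : z ∉ (algebraMap K L).range := by
  rintro ⟨c, rfl⟩
  have := hz.natDegree_minpoly
  rw [minpoly.eq_X_sub_C, natDegree_X_sub_C] at this
  omega

/-- Keeps the conventional value of `ord` at 0 out of all later estimates. -/
theorem cubic_ne_zero (w : K) : w ^ 3 + a * w + a ^ 2 ≠ 0 := by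
  intro h
  refine hz.notMem_range ⟨w, minpoly.root hz.isIntegral ?_⟩
  rw [hz.2]
  simpa using h

theorem param_ne_zero : a ≠ 0 := by
  rintro rfl
  exact hz.cubic_ne_zero 0 (by simp)

theorem sub_ne_zero (c : K) : z - algebraMap K L c ≠ 0 := fun h =>
  hz.notMem_range ⟨c, (_root_.sub_eq_zero.mp h).symm⟩

theorem ne_zero : z ≠ 0 := by
  simpa using hz.sub_ne_zero 0

theorem cubic_sub_eq_zero [CharP K 3] (c : K) :
    (z - algebraMap K L c) ^ 3 + algebraMap K L a * (z - algebraMap K L c) +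
      algebraMap K L (c ^ 3 + a * c + a ^ 2) = 0 := by
  have : CharP L 3 := charP_of_injective_algebraMap (algebraMap K L).injective 3
  have h3 : (3 : L) = 0 := CharP.ofNat_eq_zero L 3
  simp only [map_add, map_mul, map_pow]
  linear_combination hz.cubic_eq_zero +
    (z * algebraMap K L c ^ 2 - z ^ 2 * algebraMap K L c) * h3

/-- The parameters of the cubic generators of `L` are the elements `(w³ + a w + a²)² / a³`. -/
theorem exists_isCubicGenerator_iff [CharP K 3] (hdeg : Module.finrank K L = 3) (α : K) :
    (∃ x : L, IsCubicGenerator α x) ↔ ∃ w : K, α = (w ^ 3 + a * w + a ^ 2) ^ 2 / a ^ 3 := by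
  have : CharP L 3 := charP_of_injective_algebraMap (algebraMap K L).injective 3
  have h3 : (3 : L) = 0 := CharP.ofNat_eq_zero L 3
  have h3' : (3 : K) = 0 := CharP.ofNat_eq_zero K 3
  have ha := hz.param_ne_zero
  constructor
  · rintro ⟨x, hx⟩
    obtain ⟨c₀, c₁, c₂, rfl⟩ := exists_eq_quadratic hz.1 hz.natDegree_minpoly x
    have hα := hx.param_ne_zero
    -- Coordinates of x³ + αx + α² in 1, z, z², reduced by z³ = -az - a²; cubing is additive.
    obtain ⟨e0, e1, e2⟩ := eq_zero_of_quadratic_eq_zero hz.natDegree_minpoly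
      (c₀ := c₀ ^ 3 - a ^ 2 * c₁ ^ 3 + a ^ 4 * c₂ ^ 3 + α * c₀ + α ^ 2)
      (c₁ := -a * c₁ ^ 3 + 2 * a ^ 3 * c₂ ^ 3 + α * c₁)
      (c₂ := a ^ 2 * c₂ ^ 3 + α * c₂) (by
        have h1 := hx.cubic_eq_zero
        have h2 := hz.cubic_eq_zero
        simp only [map_add, map_sub, map_mul, map_pow, map_neg, map_ofNat]
        generalize algebraMap K L c₀ = d₀ at *
        generalize algebraMap K L c₁ = d₁ at *
        generalize algebraMap K L c₂ = d₂ at *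
        generalize algebraMap K L a = b at *
        generalize algebraMap K L α = β at *
        linear_combination h1 - (d₁ ^ 3 + d₂ ^ 3 * (z ^ 3 - b * z - b ^ 2)) * h2 -
          (d₀ ^ 2 * d₁ * z + d₀ * d₁ ^ 2 * z ^ 2 + d₀ ^ 2 * d₂ * z ^ 2 +
            2 * d₀ * d₁ * d₂ * z ^ 3 + d₁ ^ 2 * d₂ * z ^ 4 + d₀ * d₂ ^ 2 * z ^ 4 +
            d₁ * d₂ ^ 2 * z ^ 5) * h3)
    -- Otherwise c₁ / c₂ would be a root in K of the minimal polynomial of z.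
    have hc2 : c₂ = 0 := by
      by_contra hc
      have hα2 : α = -(a ^ 2 * c₂ ^ 2) := by
        apply mul_right_cancel₀ hc
        linear_combination e2
      apply hz.cubic_ne_zero (c₁ / c₂)
      rw [hα2] at e1
      have e3 : a * (c₁ ^ 3 + a * c₁ * c₂ ^ 2 + a ^ 2 * c₂ ^ 3) = 0 := by
        linear_combination -e1 + a ^ 3 * c₂ ^ 3 * h3'
      have e4 := (mul_eq_zero.mp e3).resolve_left ha
      field_simp
      linear_combination e4
    subst hc2
    have hc1 : c₁ ≠ 0 := by
      rintro rfl
      exact hx.notMem_range ⟨c₀, by simp⟩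
    have hα1 : α = a * c₁ ^ 2 := by
      apply mul_right_cancel₀ hc1
      linear_combination e1
    rw [hα1] at e0 ⊢
    refine ⟨-(c₀ / c₁), ?_⟩
    have e5 : (-(c₀ / c₁)) ^ 3 + a * (-(c₀ / c₁)) + a ^ 2 = a ^ 2 * c₁ := by
      field_simp
      linear_combination -e0
    rw [e5]
    field_simp
  · rintro ⟨w, hw⟩
    -- The root u(z - w) has linear coefficient au² and constant term u³f(w); the latter is (au²)²
    -- exactly for this u.
    set u := (w ^ 3 + a * w + a ^ 2) / a ^ 2 with hu
    have hu0 : u ≠ 0 := div_ne_zero (hz.cubic_ne_zero w) (pow_ne_zero _ ha)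
    have hua : w ^ 3 + a * w + a ^ 2 = a ^ 2 * u := by
      rw [hu]
      field_simp
    have hα : α = a * u ^ 2 := by
      rw [hw, hua]
      field_simp
    refine ⟨algebraMap K L u * (z - algebraMap K L w), ?_⟩
    refine adjoin_eq_top_and_minpoly_eq_of_finrank_eq_three hdeg ?_ (monic_depressedCubic _ _)
      (natDegree_depressedCubic _ _) ?_
    · rintro ⟨c, hc⟩
      refine hz.notMem_range ⟨c / u + w, ?_⟩
      have hu1 : algebraMap K L u ≠ 0 := by simpa using hu0
      rw [map_add, map_div₀, hc]
      field_simp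
      ring
    · have h1 := hz.cubic_sub_eq_zero w
      rw [hua] at h1
      simp only [map_add, map_mul, map_pow, aeval_X, aeval_C, hα] at h1 ⊢
      linear_combination algebraMap K L u ^ 3 * h1

end IsCubicGenerator

/-- The set of parameters `cubicParam a j w` does not depend on `j ∈ {1, 2}`. -/
theorem exists_cubicParam_iff [CharP K 3] (a : K) {j : ℕ} (hj : j = 1 ∨ j = 2) (Q : K → Prop) :
    (∃ w, Q (cubicParam a j w)) ↔ ∃ w, Q ((w ^ 3 + a * w + a ^ 2) ^ 2 / a ^ 3) := by
  have h3 : (3 : K) = 0 := CharP.ofNat_eq_zero K 3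
  rcases hj with rfl | rfl
  · refine exists_congr fun w => ?_
    rw [cubicParam, Nat.cast_one, one_mul, add_comm (a ^ 2)]
  -- Since 2 = -1, replacing w by -w only changes the sign of the squared element.
  · have h : ∀ w, cubicParam a 2 w = ((-w) ^ 3 + a * (-w) + a ^ 2) ^ 2 / a ^ 3 := fun w => by
      rw [cubicParam]
      congr 1
      push_cast
      linear_combination (a ^ 4 + 2 * a ^ 2 * (w ^ 3 + a * w)) * h3
    simp only [h]
    exact (Equiv.neg K).exists_congr_left.trans (by simp)

end CubicExtension

/-! ### Ramification in cubic extensions. -/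

namespace Place

section Cubic

theorem ord_param_eq {k K L : Type*} [Field k] [Field K] [Field L] [Algebra k K] [Algebra K L]
    {a : K} {z : L} (hz : IsCubicGenerator a z) (p : Place k K) (w : K) :
    p.ord ((w ^ 3 + a * w + a ^ 2) ^ 2 / a ^ 3) =
      2 * p.ord (w ^ 3 + a * w + a ^ 2) - 3 * p.ord a := by
  rw [ord_div _ (pow_ne_zero _ (hz.cubic_ne_zero w)) (pow_ne_zero _ hz.param_ne_zero), ord_pow,
    ord_pow]
  rfl

variable {k K L : Type*} [Field k] [Field K] [Field L] [Algebra k K] [Algebra k L] [Algebra K L]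
  {P : Place k L} {p : Place k K} {e : ℕ}

/-- A place is unramified in a cubic extension generated by a root of `X³ + b X + c` with
integral coefficients and `b` a unit. -/
theorem IsRamificationIndex.eq_one_of_isUnit [Finite k] [CharP k 3] [Algebra (RatFunc k) K]
    [IsScalarTower k (RatFunc k) K] [FunctionField k K] (hP : P.LiesAbove p)
    (he : P.IsRamificationIndex p e) {x : L}
    (hx : ∀ y : L, ∃ c₀ c₁ c₂ : K,
      y = algebraMap K L c₀ + algebraMap K L c₁ * x + algebraMap K L c₂ * x ^ 2)
    {b c : K} (hb0 : b ≠ 0) (hb : b ∈ p.ring) (hb' : b⁻¹ ∈ p.ring) (hc : c ∈ p.ring)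
    (h : x ^ 3 + algebraMap K L b * x + algebraMap K L c = 0) : e = 1 := by
  have hK3 : CharP K 3 := charP_of_injective_algebraMap (algebraMap k K).injective 3
  have hL3 : CharP L 3 := charP_of_injective_algebraMap (algebraMap K L).injective 3
  have h3 : (3 : L) = 0 := CharP.ofNat_eq_zero L 3
  obtain ⟨π, hπ0, hπ⟩ := p.exists_ord_eq_one
  have hπL : algebraMap K L π ≠ 0 := by simpa using hπ0
  have hπP : P.ord (algebraMap K L π) = e := by rw [he.2 π hπ0, hπ, mul_one]
  have hπp : π ∈ p.ring := by
    rw [mem_ring_iff _ hπ0]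
    omega
  let A : Subalgebra p.ring L := Algebra.adjoin p.ring {x}
  have hconst : ∀ {u : K}, u ∈ p.ring → algebraMap K L u ∈ A := fun {u} hu =>
    A.algebraMap_mem ⟨u, hu⟩
  have hxA : x ∈ A := Algebra.subset_adjoin rfl
  have hxP : x ∈ P.ring :=
    P.mem_ring_of_cubic ((hP.mem_iff b).mpr hb) ((hP.mem_iff c).mpr hc) h
  have hAP : ∀ ξ ∈ A, ξ ∈ P.ring := fun ξ hξ => by
    induction hξ using Algebra.adjoin_induction with
    | mem y hy => rw [Set.mem_singleton_iff.mp hy]; exact hxP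
    | algebraMap r => exact (hP.mem_iff (r : K)).mpr r.2
    | add y z _ _ hy hz => exact P.ring.add_mem _ _ hy hz
    | mul y z _ _ hy hz => exact P.ring.mul_mem _ _ hy hz
  -- Being a cube modulo πA. All of A has this property, so Frobenius is surjective on A/πA; no
  -- separate proof that A is integrally closed is needed.
  let Q : L → Prop := fun ξ => ∃ η ∈ A, ∃ ζ ∈ A, ξ = η ^ 3 + algebraMap K L π * ζ
  have hQadd : ∀ {y z}, Q y → Q z → Q (y + z) := by
    rintro _ _ ⟨η, hη, ζ, hζ, rfl⟩ ⟨η', hη', ζ', hζ', rfl⟩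
    exact ⟨η + η', A.add_mem hη hη', ζ + ζ', A.add_mem hζ hζ', by
      linear_combination (-η ^ 2 * η' - η * η' ^ 2) * h3⟩
  have hQmul : ∀ {y z}, Q y → Q z → Q (y * z) := by
    rintro _ _ ⟨η, hη, ζ, hζ, rfl⟩ ⟨η', hη', ζ', hζ', rfl⟩
    refine ⟨η * η', A.mul_mem hη hη',
      η ^ 3 * ζ' + ζ * η' ^ 3 + algebraMap K L π * (ζ * ζ'), ?_, by ring⟩
    exact A.add_mem (A.add_mem (A.mul_mem (pow_mem hη 3) hζ') (A.mul_mem hζ (pow_mem hη' 3)))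
      (A.mul_mem (hconst hπp) (A.mul_mem hζ hζ'))
  have hQconst : ∀ {u : K}, u ∈ p.ring → Q (algebraMap K L u) := fun {u} hu => by
    obtain ⟨s, hs, v, hv, rfl⟩ := p.exists_eq_cube_add hπ0 hπ hu
    exact ⟨_, hconst hs, _, hconst hv, by simp⟩
  have hQx : Q x := by
    have hbL : algebraMap K L b ≠ 0 := by simpa using hb0
    -- As b is a unit, the equation can be solved for its linear term.
    have hx3 : x = algebraMap K L (-b⁻¹) * x ^ 3 + algebraMap K L (-(c * b⁻¹)) := by
      simp only [map_neg, map_mul, map_inv₀]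
      field_simp
      linear_combination h
    rw [hx3]
    exact hQadd (hQmul (hQconst (p.ring.neg_mem _ hb')) ⟨x, hxA, 0, A.zero_mem, by simp⟩)
      (hQconst (p.ring.neg_mem _ (p.ring.mul_mem _ _ hc hb')))
  have hQA : ∀ ξ ∈ A, Q ξ := fun ξ hξ => by
    induction hξ using Algebra.adjoin_induction with
    | mem y hy => rw [Set.mem_singleton_iff.mp hy]; exact hQx
    | algebraMap r => exact hQconst r.2
    | add y z _ _ hy hz => exact hQadd hy hz
    | mul y z _ _ hy hz => exact hQmul hy hz
  have hiter : ∀ N : ℕ, ∀ ξ ∈ A, ∃ η ∈ A, ∃ ζ ∈ A,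
      ξ = η ^ 3 ^ (N + 1) + algebraMap K L π * ζ := by
    intro N
    induction N with
    | zero => simpa using hQA
    | succ N ih =>
      intro ξ hξ
      obtain ⟨η, hη, ζ, hζ, rfl⟩ := ih ξ hξ
      obtain ⟨η', hη', ζ', hζ', rfl⟩ := hQA η hη
      refine ⟨η', hη', algebraMap K L π ^ (3 ^ (N + 1) - 1) * ζ' ^ 3 ^ (N + 1) + ζ,
        A.add_mem (A.mul_mem (pow_mem (hconst hπp) _) (pow_mem hζ' _)) hζ, ?_⟩
      have : Fact (Nat.Prime 3) := ⟨Nat.prime_three⟩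
      rw [add_pow_char_pow, mul_pow, ← pow_mul, ← pow_succ', mul_add, ← mul_assoc, ← pow_succ',
        Nat.sub_add_cancel (Nat.one_le_pow _ _ (by norm_num)), add_assoc]
  have hepos : 0 < e := he.1
  -- Descent: write ξ = η ^ 3 ^ (n + 1) + πζ with n > 0. Then η is no unit at P, so its power has
  -- order above n or vanishes, and n = e + ord ζ.
  have hdesc : ∀ n : ℕ, ∀ ξ ∈ A, ξ ≠ 0 → P.ord ξ = n → (e : ℤ) ∣ n := by
    intro n
    induction n using Nat.strong_induction_on with
    | _ n ih =>
      intro ξ hξ hξ0 hn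
      by_cases hn0 : n = 0
      · simp [hn0]
      obtain ⟨η, hη, ζ, hζ, hsum⟩ := hiter n ξ hξ
      have hlt : n < 3 ^ (n + 1) := (Nat.lt_pow_self (by norm_num)).trans
        (Nat.pow_lt_pow_right (by norm_num) (Nat.lt_succ_self n))
      have key : ζ ≠ 0 → P.ord (algebraMap K L π * ζ) = n → (e : ℤ) ∣ n := by
        intro hζ0 h1
        rw [ord_mul _ hπL hζ0, hπP] at h1
        have h2 := (mem_ring_iff _ hζ0).mp (hAP ζ hζ)
        have h4 := ih (P.ord ζ).toNat (by omega) ζ hζ hζ0 (by omega)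
        rw [← h1, ← Int.toNat_of_nonneg h2]
        exact dvd_add_self_left.mpr h4
      by_cases hη0 : η = 0
      · rw [hη0, zero_pow (by positivity), zero_add] at hsum
        refine key ?_ (hsum ▸ hn)
        rintro rfl
        simp [hξ0] at hsum
      have h5 := (mem_ring_iff _ hη0).mp (hAP η hη)
      have hηpow : η ^ 3 ^ (n + 1) ≠ 0 := pow_ne_zero _ hη0
      have hηord : P.ord (η ^ 3 ^ (n + 1)) = (3 ^ (n + 1) : ℕ) * P.ord η := ord_pow _ _ _
      by_cases hζ0 : ζ = 0
      · rw [hζ0, mul_zero, add_zero] at hsum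
        rw [hsum, hηord] at hn
        exfalso
        rcases h5.eq_or_lt with h6 | h6
        · rw [← h6] at hn
          omega
        · have : ((3 ^ (n + 1) : ℕ) : ℤ) ≤ (3 ^ (n + 1) : ℕ) * P.ord η :=
            le_mul_of_one_le_right (by positivity) h6
          omega
      have hζmem := (mem_ring_iff _ hζ0).mp (hAP ζ hζ)
      have hπζ0 : algebraMap K L π * ζ ≠ 0 := mul_ne_zero hπL hζ0
      have hπζ : P.ord (algebraMap K L π * ζ) = e + P.ord ζ := by
        rw [ord_mul _ hπL hζ0, hπP]
      rcases h5.eq_or_lt with h6 | h6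
      · rw [← h6, mul_zero] at hηord
        have h7 := (P.ord_add_of_lt hηpow hπζ0 (by omega)).2
        rw [← hsum] at h7
        omega
      · refine key hζ0 ?_
        have h8 : ((3 ^ (n + 1) : ℕ) : ℤ) ≤ (3 ^ (n + 1) : ℕ) * P.ord η :=
          le_mul_of_one_le_right (by positivity) h6
        have h9 : P.ord ξ < P.ord (-η ^ 3 ^ (n + 1)) := by
          rw [ord_neg]
          omega
        have h10 := (P.ord_add_of_lt hξ0 (neg_ne_zero.mpr hηpow) h9).2
        rw [hsum, add_neg_cancel_comm, ← hsum] at h10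
        omega
  have hclear : ∀ u : K, ∃ n : ℕ, ∀ m, n ≤ m → π ^ m * u ∈ p.ring := fun u => by
    by_cases hu : u = 0
    · exact ⟨0, fun m _ => by rw [hu, mul_zero]; exact p.ring.zero_mem⟩
    refine ⟨(-p.ord u).toNat, fun m hm => ?_⟩
    rw [mem_ring_iff _ (mul_ne_zero (pow_ne_zero _ hπ0) hu), ord_mul _ (pow_ne_zero _ hπ0) hu,
      ord_pow, hπ]
    omega
  obtain ⟨ϖ, hϖ0, hϖ⟩ := P.exists_ord_eq_one
  obtain ⟨c₀, c₁, c₂, hϖc⟩ := hx ϖ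
  obtain ⟨n₀, hn₀⟩ := hclear c₀
  obtain ⟨n₁, hn₁⟩ := hclear c₁
  obtain ⟨n₂, hn₂⟩ := hclear c₂
  set N := n₀ + n₁ + n₂ with hN
  -- Clearing denominators puts an element of order Ne + 1 in A, so e divides 1.
  have hmem : algebraMap K L π ^ N * ϖ ∈ A := by
    have : algebraMap K L π ^ N * ϖ = algebraMap K L (π ^ N * c₀) +
        algebraMap K L (π ^ N * c₁) * x + algebraMap K L (π ^ N * c₂) * x ^ 2 := by
      rw [hϖc]
      simp only [map_mul, map_pow]
      ring
    rw [this]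
    exact A.add_mem (A.add_mem (hconst (hn₀ N (by omega)))
      (A.mul_mem (hconst (hn₁ N (by omega))) hxA))
      (A.mul_mem (hconst (hn₂ N (by omega))) (pow_mem hxA 2))
  have hord : P.ord (algebraMap K L π ^ N * ϖ) = (N * e + 1 : ℕ) := by
    rw [ord_mul _ (pow_ne_zero _ hπL) hϖ0, ord_pow, hπP, hϖ]
    push_cast
    ring
  have hdvd := hdesc _ _ hmem (mul_ne_zero (pow_ne_zero _ hπL) hϖ0) hord
  rw [Int.natCast_dvd_natCast, Nat.dvd_add_right (Dvd.intro_left _ rfl), Nat.dvd_one] at hdvd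
  exact hdvd

/-! ### Reading ramification off the equation of a generator. -/

section Generator

variable {a : K} {z : L} (hz : IsCubicGenerator a z)
include hz

/-- A root of `X³ + a X + a²` with `ord a` even and nonnegative generates an extension
unramified at `p`. -/
theorem IsRamificationIndex.eq_one_of_even [Finite k] [CharP k 3] [Algebra (RatFunc k) K]
    [IsScalarTower k (RatFunc k) K] [FunctionField k K] (hP : P.LiesAbove p)
    (he : P.IsRamificationIndex p e) (ha0 : 0 ≤ p.ord a) (ha2 : Even (p.ord a)) : e = 1 := by
  obtain ⟨π, hπ0, hπ⟩ := p.exists_ord_eq_one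
  have hπL : algebraMap K L π ≠ 0 := by simpa using hπ0
  have ha := hz.param_ne_zero
  obtain ⟨r, hr⟩ := ha2
  obtain ⟨n, rfl⟩ := Int.eq_ofNat_of_zero_le (show 0 ≤ r by omega)
  have hpow : ∀ m, π ^ m ≠ 0 := fun m => pow_ne_zero m hπ0
  have hb0 : a / π ^ (2 * n) ≠ 0 := div_ne_zero ha (hpow _)
  have hb : p.ord (a / π ^ (2 * n)) = 0 := by
    rw [ord_div _ ha (hpow _), ord_pow, hπ]
    push_cast
    omega
  -- With ord a = 2n, the new linear coefficient has order 0 and the new constant term has order n.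
  refine he.eq_one_of_isUnit hP (x := z / algebraMap K L π ^ n) (b := a / π ^ (2 * n))
    (c := a ^ 2 / π ^ (3 * n)) ?_ hb0 ?_ ?_ ?_ ?_
  · intro y
    obtain ⟨c₀, c₁, c₂, rfl⟩ := exists_eq_quadratic hz.1 hz.natDegree_minpoly y
    refine ⟨c₀, π ^ n * c₁, π ^ n * π ^ n * c₂, ?_⟩
    simp only [map_mul, map_pow]
    field_simp
  · rw [mem_ring_iff _ hb0, hb]
  · rw [mem_ring_iff _ (inv_ne_zero hb0), ord_inv, hb, neg_zero]
  · rw [mem_ring_iff _ (div_ne_zero (pow_ne_zero _ ha) (hpow _)),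
      ord_div _ (pow_ne_zero _ ha) (hpow _), ord_pow, ord_pow, hπ]
    push_cast
    omega
  · have := hz.cubic_eq_zero
    have hπn := pow_ne_zero n hπL
    simp only [map_div₀, map_pow, pow_mul' _ 2 n, pow_mul' _ 3 n]
    field_simp
    linear_combination this

/-- The possible relations between the orders of the terms of the equation of `z - c`. -/
theorem IsRamificationIndex.ord_sub_cases [CharP K 3] (he : P.IsRamificationIndex p e) (c : K)
    {ν A m : ℤ} (hν : P.ord (z - algebraMap K L c) = ν) (hA : e * p.ord a = A)
    (hm : e * p.ord (c ^ 3 + a * c + a ^ 2) = m) :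
    3 * ν = A + ν ∧ 3 * ν ≤ m ∨ 3 * ν = m ∧ m ≤ A + ν ∨ A + ν = m ∧ m ≤ 3 * ν := by
  have hh := hz.sub_ne_zero c
  have ha : algebraMap K L a ≠ 0 := by simpa using hz.param_ne_zero
  have hf : algebraMap K L (c ^ 3 + a * c + a ^ 2) ≠ 0 :=
    (_root_.map_ne_zero _).mpr (hz.cubic_ne_zero c)
  have h := hz.cubic_sub_eq_zero c
  have e1 : P.ord ((z - algebraMap K L c) ^ 3) = 3 * ν := by rw [ord_pow, hν]; rfl
  have e2 : P.ord (algebraMap K L a * (z - algebraMap K L c)) = A + ν := by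
    rw [ord_mul _ ha hh, he.2 _ hz.param_ne_zero, hν, hA]
  have e3 : P.ord (algebraMap K L (c ^ 3 + a * c + a ^ 2)) = m := by
    rw [he.2 _ (hz.cubic_ne_zero c), hm]
  have h1 := P.not_ord_lt_of_add_eq_zero (pow_ne_zero 3 hh) (mul_ne_zero ha hh) h
  have h2 := P.not_ord_lt_of_add_eq_zero (mul_ne_zero ha hh) (pow_ne_zero 3 hh)
    (by rwa [add_comm (_ * _)])
  have h3 := P.not_ord_lt_of_add_eq_zero hf (pow_ne_zero 3 hh)
    (by rwa [add_assoc, add_comm])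
  rw [e1, e2, e3] at h1 h2 h3
  omega

/-- If `P` is fully ramified over `p`, some translate `z - c` has order prime to `3`, and then
`(c³ + a c + a²)² / a³` has negative order prime to `3`. -/
theorem IsRamificationIndex.exists_ord_sub_eq [CharP K 3] (hdeg : Module.finrank K L = 3)
    (he : P.IsRamificationIndex p 3) :
    ∃ c : K, ¬ 3 ∣ P.ord (z - algebraMap K L c) ∧
      P.ord (z - algebraMap K L c) = p.ord (c ^ 3 + a * c + a ^ 2) ∧
      2 * p.ord (c ^ 3 + a * c + a ^ 2) < 3 * p.ord a := by
  have hfd : FiniteDimensional K L := FiniteDimensional.of_finrank_eq_succ hdeg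
  obtain ⟨c, hc⟩ := he.exists_not_dvd_ord_sub hdeg.symm hz.notMem_range
  refine ⟨c, hc, ?_⟩
  -- With e = 3 and 3 ∤ ν, the linear term cannot tie with another: a tie would give 3 ∣ 2ν or 3 ∣
  -- ν.
  have := he.ord_sub_cases hz c rfl rfl rfl
  push_cast at *
  omega

/-- If `ord a` is negative and prime to `3`, then `p` is fully ramified. -/
theorem fullyRamified_of_not_dvd [CharP K 3] [IsScalarTower k K L] [Algebra.IsSeparable K L]
    (hdeg : Module.finrank K L = 3) (ha0 : p.ord a < 0) (ha3 : ¬ 3 ∣ p.ord a) :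
    p.FullyRamified L := by
  have hfd : FiniteDimensional K L := FiniteDimensional.of_finrank_eq_succ hdeg
  obtain ⟨P, hP⟩ := exists_liesAbove (L := L) p
  obtain ⟨e, he⟩ := hP.exists_isRamificationIndex
  refine ⟨P, hP, ?_⟩
  have hle := he.le_finrank
  have hpos := he.1
  rw [hdeg] at hle ⊢
  have h := he.ord_sub_cases hz 0 rfl rfl rfl
  have h0 : p.ord ((0 : K) ^ 3 + a * 0 + a ^ 2) = 2 * p.ord a := by
    rw [show (0 : K) ^ 3 + a * 0 + a ^ 2 = a ^ 2 by ring, ord_pow]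
    rfl
  rw [h0] at h
  -- As ord a < 0, the only possible tie is 3 ord z = 2e ord a, whence 3 ∣ e.
  interval_cases e
  · omega
  · omega
  · exact he

/-- If e = 3, parity forces ord z = 3 ord a, above the order of a suitable z - c. So ord (z - c) is
the order of c, a multiple of 3, contrary to the choice of c. -/
theorem not_fullyRamified_of_odd [CharP K 3] (hdeg : Module.finrank K L = 3)
    (ha0 : 0 ≤ p.ord a) (ha2 : Odd (p.ord a)) : ¬ p.FullyRamified L := by
  rintro ⟨P, -, he⟩
  rw [hdeg] at he
  obtain ⟨c, hc3, -, hc⟩ := he.exists_ord_sub_eq hz hdeg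
  obtain ⟨r, hr⟩ := ha2
  have h := he.ord_sub_cases hz 0 rfl rfl rfl
  have h' := he.ord_sub_cases hz c rfl rfl rfl
  have h0 : p.ord ((0 : K) ^ 3 + a * 0 + a ^ 2) = 2 * p.ord a := by
    rw [show (0 : K) ^ 3 + a * 0 + a ^ 2 = a ^ 2 by ring, ord_pow]
    rfl
  rw [h0, map_zero, sub_zero] at h
  push_cast at h h'
  have hz3 : P.ord z = 3 * p.ord a := by omega
  have hc0 : c ≠ 0 := by
    rintro rfl
    rw [map_zero, sub_zero] at hc3
    omega
  have hlt : P.ord (z - algebraMap K L c) < P.ord (-z) := by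
    rw [ord_neg]
    omega
  have h1 := (P.ord_add_of_lt (hz.sub_ne_zero c) (neg_ne_zero.mpr hz.ne_zero) hlt).2
  rw [show z - algebraMap K L c + -z = -algebraMap K L c by ring, ord_neg, he.2 c hc0] at h1
  push_cast at h1
  omega

/-- The element t = z / a satisfies a t³ + t + 1 = 0 and is not integral, since a⁻¹ is not. At a
pole of t the first two terms tie, so 2 ord t = -e ord a excludes e = 1. -/
theorem ramified_of_odd [IsScalarTower k K L] [Algebra.IsSeparable K L]
    (hdeg : Module.finrank K L = 3) (ha0 : 0 ≤ p.ord a) (ha2 : Odd (p.ord a)) :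
    p.Ramified L := by
  have hfd : FiniteDimensional K L := FiniteDimensional.of_finrank_eq_succ hdeg
  have ha := hz.param_ne_zero
  have haL : algebraMap K L a ≠ 0 := by simpa using ha
  obtain ⟨r, hr⟩ := ha2
  set t := z / algebraMap K L a with ht
  have ht0 : t ≠ 0 := div_ne_zero hz.ne_zero haL
  have hteq : algebraMap K L a * t ^ 3 + t + 1 = 0 := by
    have := hz.cubic_eq_zero
    rw [ht]
    field_simp
    linear_combination this
  have htK : t ∉ (algebraMap K L).range := by
    rintro ⟨c, hc⟩
    refine hz.notMem_range ⟨c * a, ?_⟩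
    rw [map_mul, hc, ht]
    field_simp
  have hmin := (adjoin_eq_top_and_minpoly_eq_of_finrank_eq_three hdeg htK
    (monic_depressedCubic a⁻¹ a⁻¹) (natDegree_depressedCubic _ _) (by
      simp only [map_add, map_mul, map_pow, aeval_X, aeval_C, map_inv₀]
      field_simp
      linear_combination hteq)).2
  have hnint : ¬ IsIntegral p.ring t := fun hint => by
    have h1 := minpoly.isIntegrallyClosed_eq_field_fractions' K hint
    have h2 : algebraMap p.ring K ((minpoly p.ring t).coeff 0) = a⁻¹ := by
      rw [← coeff_map, ← h1, hmin]
      simp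
    have h3 : a⁻¹ ∈ p.ring := h2 ▸ Subtype.prop ((minpoly p.ring t).coeff 0)
    rw [mem_ring_iff _ (inv_ne_zero ha), ord_inv] at h3
    omega
  obtain ⟨P, hP, htP⟩ := p.exists_liesAbove_notMem hnint
  obtain ⟨e, he⟩ := hP.exists_isRamificationIndex
  refine ⟨P, hP, e, he, ?_⟩
  rw [mem_ring_iff _ ht0] at htP
  have e1 : P.ord (algebraMap K L a * t ^ 3) = e * p.ord a + 3 * P.ord t := by
    rw [ord_mul _ haL (pow_ne_zero _ ht0), he.2 _ ha, ord_pow]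
    rfl
  have h1 := P.not_ord_lt_of_add_eq_zero (mul_ne_zero haL (pow_ne_zero 3 ht0)) ht0 hteq
  have h2 := P.not_ord_lt_of_add_eq_zero ht0 (mul_ne_zero haL (pow_ne_zero 3 ht0))
    (by rwa [add_comm t])
  rw [e1, ord_one] at h1 h2
  by_contra hle
  have hpos := he.1
  obtain rfl : e = 1 := by omega
  push_cast at h1 h2
  omega

/-- If the ramification index of some place above `p` is prime to `3`, then `L` has a parameter
that is integral at `p`. -/
theorem IsRamificationIndex.exists_le_two_mul_ord [Finite k] [CharP k 3] [Algebra (RatFunc k) K]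
    [IsScalarTower k (RatFunc k) K] [FunctionField k K]
    (he : P.IsRamificationIndex p e) (he3 : ¬ 3 ∣ e) :
    ∃ c : K, 3 * p.ord a ≤ 2 * p.ord (c ^ 3 + a * c + a ^ 2) := by
  have hK3 : CharP K 3 := charP_of_injective_algebraMap (algebraMap k K).injective 3
  have h3 : (3 : K) = 0 := CharP.ofNat_eq_zero K 3
  by_contra! hlt
  have ha := hz.param_ne_zero
  obtain ⟨π, hπ0, hπ⟩ := p.exists_ord_eq_one
  obtain ⟨m, ⟨c, hc⟩, hmax⟩ := Int.exists_greatest_of_bdd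
    (P := fun m => ∃ c : K, p.ord (c ^ 3 + a * c + a ^ 2) = m)
    ⟨2 * |p.ord a|, by
      rintro _ ⟨c, rfl⟩
      have := hlt c
      rcases abs_cases (p.ord a) with h | h <;> omega⟩ ⟨_, 0, rfl⟩
  have h2 := hlt c
  rw [hc] at h2
  have hcases := he.ord_sub_cases hz c rfl rfl rfl
  rw [hc] at hcases
  have hpos : (0 : ℤ) < e := by exact_mod_cast he.1
  have h4 : 2 * (e * m) < 3 * (e * p.ord a) := by nlinarith
  -- The bound on m leaves only the tie of (z - c)³ with the constant term.
  have h5 : 3 ∣ (e : ℤ) * m := by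
    generalize (e : ℤ) * m = M at *
    generalize (e : ℤ) * p.ord a = A at *
    omega
  have h6 : (3 : ℤ) ∣ m := (Int.prime_three.dvd_or_dvd h5).resolve_left (by exact_mod_cast he3)
  obtain ⟨r, rfl⟩ := h6
  set f := c ^ 3 + a * c + a ^ 2 with hf
  have hf0 : f ≠ 0 := hz.cubic_ne_zero c
  have hzp : ∀ n : ℤ, π ^ n ≠ 0 := fun n => zpow_ne_zero n hπ0
  have hu : f / π ^ (3 * r) ∈ p.ring := by
    rw [mem_ring_iff _ (div_ne_zero hf0 (hzp _)), ord_div _ hf0 (hzp _), ord_zpow, hπ]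
    omega
  obtain ⟨s, hs, v, hv, hsv⟩ := p.exists_eq_cube_add hπ0 hπ hu
  have hfe : f = (s * π ^ r) ^ 3 + π ^ (3 * r + 1) * v := by
    rw [div_eq_iff (hzp _)] at hsv
    rw [hsv, zpow_add_one₀ hπ0, mul_comm 3 r, zpow_mul]
    norm_cast
    ring
  -- This cancels the leading term of f(c). The error a s π ^ r has order at least 3r + 1 when
  -- nonzero, because ord a > 2r.
  set c' := c - s * π ^ r with hc'
  have hf' : c' ^ 3 + a * c' + a ^ 2 = π ^ (3 * r + 1) * v - a * (s * π ^ r) := by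
    rw [hc']
    linear_combination hfe - (c ^ 2 * (s * π ^ r) - c * (s * π ^ r) ^ 2) * h3
  have hquot : (c' ^ 3 + a * c' + a ^ 2) / π ^ (3 * r + 1) ∈ p.ring := by
    have h7 : (c' ^ 3 + a * c' + a ^ 2) / π ^ (3 * r + 1) = v - a / π ^ (2 * r + 1) * s := by
      have h8 : π ^ (3 * r + 1) = π ^ (2 * r + 1) * π ^ r := by
        rw [← zpow_add₀ hπ0]
        congr 1
        ring
      have h9 := hzp (2 * r + 1)
      have h10 := hzp r
      rw [hf', h8]
      field_simp
    rw [h7]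
    refine p.ring.sub_mem hv (p.ring.mul_mem _ _ ?_ hs)
    rw [mem_ring_iff _ (div_ne_zero ha (hzp _)), ord_div _ ha (hzp _), ord_zpow, hπ]
    omega
  have hf0' := hz.cubic_ne_zero c'
  rw [mem_ring_iff _ (div_ne_zero hf0' (hzp _)), ord_div _ hf0' (hzp _), ord_zpow, hπ] at hquot
  have := hmax _ ⟨c', rfl⟩
  omega

end Generator

end Cubic

end Place

/-! ### Assembly of the two criteria. -/

theorem Int.gcd_eq_one_iff_not_dvd {q : ℕ} (hq : q.Prime) (n : ℤ) :
    Int.gcd n q = 1 ↔ ¬ (q : ℤ) ∣ n := by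
  rw [Int.gcd_comm, ← Int.isCoprime_iff_gcd_eq_one]
  exact (Nat.prime_iff_prime_int.mp hq).coprime_iff_not_dvd

theorem mainTheorem6
    {k K L : Type*} [Field k] [Finite k] [CharP k 3]
    [Field K] [Algebra k K] [Algebra (RatFunc k) K] [IsScalarTower k (RatFunc k) K]
    [FunctionField k K]
    [Field L] [Algebra k L] [Algebra K L] [IsScalarTower k K L]
    [Algebra.IsSeparable K L] (hdeg : Module.finrank K L = 3)
    (a : K) (y : L) (hy : IsCubicGenerator a y)
    (j : ℕ) (hj : j = 1 ∨ j = 2)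
    (p : Place k K) :
    ((p.FullyRamified L ↔
        ∃ w : K, p.ord (cubicParam a j w) < 0 ∧ Int.gcd (p.ord (cubicParam a j w)) 3 = 1) ∧
      ((∃ w : K, p.ord (cubicParam a j w) < 0 ∧ Int.gcd (p.ord (cubicParam a j w)) 3 = 1) ↔
        ∃ (α : K) (z : L), IsCubicGenerator α z ∧ p.ord α < 0 ∧ Int.gcd (p.ord α) 3 = 1)) ∧
    ((p.PartiallyRamified L ↔
        Int.gcd (p.ord a) 2 = 1 ∧ ∃ w : K, 0 ≤ p.ord (cubicParam a j w)) ∧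
      ((∃ w : K, 0 ≤ p.ord (cubicParam a j w)) ↔
        ∃ (α : K) (z : L), IsCubicGenerator α z ∧ 0 ≤ p.ord α)) := by
  have hK3 : CharP K 3 := charP_of_injective_algebraMap (algebraMap k K).injective 3
  have hfd : FiniteDimensional K L := FiniteDimensional.of_finrank_eq_succ hdeg
  have hgcd3 : ∀ n : ℤ, Int.gcd n 3 = 1 ↔ ¬ 3 ∣ n := Int.gcd_eq_one_iff_not_dvd Nat.prime_three
  have hgcd2 : ∀ n : ℤ, Int.gcd n 2 = 1 ↔ ¬ 2 ∣ n := Int.gcd_eq_one_iff_not_dvd Nat.prime_two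
  have hparam : ∀ Q : K → Prop,
      (∃ w, Q (cubicParam a j w)) ↔ ∃ (α : K) (z : L), IsCubicGenerator α z ∧ Q α := fun Q => by
    rw [exists_cubicParam_iff a hj]
    constructor
    · rintro ⟨w, hw⟩
      obtain ⟨z, hz⟩ := (hy.exists_isCubicGenerator_iff hdeg _).mpr ⟨w, rfl⟩
      exact ⟨_, z, hz, hw⟩
    · rintro ⟨α, z, hz, hα⟩
      obtain ⟨w, rfl⟩ := (hy.exists_isCubicGenerator_iff hdeg α).mp ⟨z, hz⟩
      exact ⟨w, hα⟩
  have hparity : ∀ (α : K) (z : L), IsCubicGenerator α z → (2 ∣ p.ord α ↔ 2 ∣ p.ord a) :=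
    fun α z hz => by
      obtain ⟨w, rfl⟩ := (hy.exists_isCubicGenerator_iff hdeg α).mp ⟨z, hz⟩
      rw [Place.ord_param_eq hy]
      omega
  simp only [hgcd3, hgcd2]
  refine ⟨⟨⟨?_, ?_⟩, hparam fun α => p.ord α < 0 ∧ ¬ 3 ∣ p.ord α⟩,
    ⟨?_, ?_⟩, hparam fun α => 0 ≤ p.ord α⟩
  · rintro ⟨P, -, he⟩
    rw [hdeg] at he
    obtain ⟨c, h1, h2, h3⟩ := he.exists_ord_sub_eq hy hdeg
    refine (exists_cubicParam_iff a hj fun α => p.ord α < 0 ∧ ¬ 3 ∣ p.ord α).mpr ⟨c, ?_⟩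
    rw [Place.ord_param_eq hy]
    omega
  · intro h
    obtain ⟨α, z, hz, h1, h2⟩ := (hparam fun α => p.ord α < 0 ∧ ¬ 3 ∣ p.ord α).mp h
    exact Place.fullyRamified_of_not_dvd hz hdeg h1 h2
  · rintro ⟨⟨P, hP, e, he, he1⟩, hnot⟩
    have hle := he.le_finrank
    have hne : e ≠ 3 := by
      rintro rfl
      exact hnot ⟨P, hP, hdeg.symm ▸ he⟩
    obtain rfl : e = 2 := by omega
    obtain ⟨c, hc⟩ := he.exists_le_two_mul_ord hy (by norm_num)
    have hex : ∃ w, 0 ≤ p.ord (cubicParam a j w) := by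
      refine (exists_cubicParam_iff a hj fun α => 0 ≤ p.ord α).mpr ⟨c, ?_⟩
      rw [Place.ord_param_eq hy]
      omega
    refine ⟨fun h2 => ?_, hex⟩
    -- An even ord a makes ord α even, which would give e = 1 rather than 2.
    obtain ⟨α, z, hz, hα⟩ := (hparam fun α => 0 ≤ p.ord α).mp hex
    have := he.eq_one_of_even hz hP hα (even_iff_two_dvd.mpr ((hparity α z hz).mpr h2))
    omega
  · rintro ⟨h2, hex⟩
    obtain ⟨α, z, hz, hα⟩ := (hparam fun α => 0 ≤ p.ord α).mp hex
    have hodd : Odd (p.ord α) := by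
      rw [← Int.not_even_iff_odd, even_iff_two_dvd, hparity α z hz]
      exact h2
    exact ⟨Place.ramified_of_odd hz hdeg hα hodd, Place.not_fullyRamified_of_odd hz hdeg hα hodd⟩
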